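/- Let $(X,d,\mu)$ be a proper metric measure space, i.e. $(X,d)$ is a metric space in which closed balls are compact, and $\mu$ is a Borel measure on $X$ that is positive and finite on every open ball. Let $1\le Q<p<\infty$, let $Y$ be any metric space, and write $B(x,r)$ for open balls. A Borel function $g\colon X\to[0,\infty]$ is an upper gradient of a map $f\colon X\to Y$ if $d_Y(f(\gamma(0)),f(\gamma(1)))\le\int_\gamma g\,ds$ for every rectifiable curve $\gamma\colon[0,1]\to X$. Assume: (i) ($X$ is locally $Q$-homogeneous) for every compact $K\subseteq X$ there are $R>0$ and $C\ge1$ such that $$\frac{\mu(B(x,r_2))}{r_2^Q}\le C\,\frac{\mu(B(x,r_1))}{r_1^Q}\qquad\text{for all }x\in K,\ 0<r_1\le r_2<R;$$ (ii) ($X$ supports a local $Q$-Poincaré inequality) for every compact $K\subseteq X$ there are $C\ge1$, $\sigma\ge1$ and $R>0$ such that for every continuous $u\colon X\to\mathbb R$, every upper gradient $g$ of $u$, and every ball $B=B(x,r)$ with $x\in K$ and $0<r<R$, $$\frac1{\mu(B)}\int_B|u-u_B|\,d\mu\le C\,\operatorname{diam}(B)\left(\frac1{\mu(\sigma B)}\int_{\sigma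 B}g^Q\,d\mu\right)^{1/Q},$$ where $u_B=\frac1{\mu(B)}\int_B u\,d\mu$ and $\sigma B=B(x,\sigma r)$. Let $f\colon X\to Y$ be a continuous map that has an upper gradient $g\in L^p_{\mathrm{loc}}(X)$, i.e. $\int_K g^p\,d\mu<\infty$ for every compact $K\subseteq X$. Then, with $\dim$ the Hausdorff dimension and $\mathcal H^Q$ the $Q$-dimensional Hausdorff measure, $$\dim f(E)\le\frac{p\,\dim E}{p-Q+\dim E}\qquad\text{for every } E\subseteq X.$$ Moreover, for every $E\subseteq X$, if $\mathcal H^Q_X(E)=0$, then $\mathcal H^Q_Y(f(E))=0$. -/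

import Mathlib

open MeasureTheory Set
open scoped ENNReal

noncomputable section

/-- A curve `γ : [0,1] → X` is rectifiable if it has finite length. -/
def RectifiableCurve {X : Type*} [MetricSpace X] (γ : C(unitInterval, X)) : Prop :=
  eVariationOn γ univ ≠ ∞

/-- The line integral `∫_γ g ds` over a rectifiable curve: the integral over `[0, length γ]` of
`g` composed with the arc-length parametrization of `γ`. -/
def lineIntegral {X : Type*} [MetricSpace X] (g : X → ℝ≥0∞) (γ : C(unitInterval, X)) : ℝ≥0∞ :=
  ∫⁻ t in Icc (0 : ℝ) (eVariationOn γ univ).toReal, g (naturalParameterization γ univ 0 t)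

/-- The Borel function `g : X → [0,∞]` is an upper gradient of `f : X → Y`. -/
structure IsUpperGradient {X Y : Type*} [MetricSpace X] [MeasurableSpace X] [MetricSpace Y]
    (f : X → Y) (g : X → ℝ≥0∞) : Prop where
  measurable : Measurable g
  edist_le : ∀ γ : C(unitInterval, X), RectifiableCurve γ →
    edist (f (γ 0)) (f (γ 1)) ≤ lineIntegral g γ

/-- The function `g : X → [0,∞]` belongs to `L^p_loc(X)` (`X` is proper where this is used). -/
def LocallyLp {X : Type*} [MetricSpace X] [MeasurableSpace X] (μ : Measure X) (p : ℝ)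
    (g : X → ℝ≥0∞) : Prop :=
  AEMeasurable g μ ∧ ∀ K : Set X, IsCompact K → ∫⁻ x in K, g x ^ p ∂μ < ∞

/-- Local `Q`-homogeneity:
`μ(B(x,r₂)) / r₂^Q ≤ C μ(B(x,r₁)) / r₁^Q` for `x ∈ K` and `0 < r₁ ≤ r₂ < R`. -/
def LocallyHomogeneous {X : Type*} [MetricSpace X] [MeasurableSpace X] (μ : Measure X)
    (Q : ℝ) : Prop :=
  ∀ K : Set X, IsCompact K → ∃ R C : ℝ, 0 < R ∧ 1 ≤ C ∧
    ∀ x ∈ K, ∀ r₁ r₂ : ℝ, 0 < r₁ → r₁ ≤ r₂ → r₂ < R →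
      μ (Metric.ball x r₂) / ENNReal.ofReal (r₂ ^ Q) ≤
        ENNReal.ofReal C * (μ (Metric.ball x r₁) / ENNReal.ofReal (r₁ ^ Q))

/-- The local `q`-Poincaré inequality. Here `⨍` and `⨍⁻` are averages, and `σ B = B(x, σ r)` for
`B = B(x, r)`. -/
def LocalPoincare {X : Type*} [MetricSpace X] [MeasurableSpace X] (μ : Measure X)
    (q : ℝ) : Prop :=
  ∀ K : Set X, IsCompact K → ∃ C σ R : ℝ, 1 ≤ C ∧ 1 ≤ σ ∧ 0 < R ∧
    ∀ (u : X → ℝ) (g : X → ℝ≥0∞), Continuous u → IsUpperGradient u g →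
      ∀ x ∈ K, ∀ r : ℝ, 0 < r → r < R →
        ⨍⁻ y in Metric.ball x r, ‖u y - ⨍ z in Metric.ball x r, u z ∂μ‖ₑ ∂μ ≤
          ENNReal.ofReal C * Metric.ediam (Metric.ball x r) *
            (⨍⁻ y in Metric.ball x (σ * r), g y ^ q ∂μ) ^ (1 / q)

end

/-! ### Averages over sets of finite measure -/

section Averages

variable {X : Type*} [MeasurableSpace X] {μ : Measure X}

/-! Fix `q` with `Q < q < p`. Telescoping the Poincaré inequality over concentric balls of halving
radius gives a Morrey estimate (`IsUpperGradient.exists_edist_le`): the oscillation of `f` on `B(x,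
r)` is at most a constant times `r (⨍ g^q)^(1/q)`, the average being over `B(x, Λ r)`. The series
converges because `q > Q`: by homogeneity, averages of `g^q` grow at most like `2^(kQ)` when the
ball shrinks by `2^k`, so the terms decay like `2^(k(Q/q - 1))`.

Now let `E` lie in a compact set, let `H^s(E) = 0` and `t = ps/(p - Q + s)`. Cover `E` by balls with
`∑ r_i^s` small, extract a disjoint subfamily by Vitali, and cover `f(E)` by the images of the
6-fold enlargements. The relation between `s` and `t` says `t = s(1 - t/p) + Q t/p`. Hence the lower
mass bound `r^Q ≲ μ(B(x, r))` and Hölder's inequality bound the sum of the `t`-th powers of the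
diameters by `(∑ r_i^s)^(1 - t/p) (∑ μ(B_i) a_i^(p/q))^(t/p)`, up to constants, where `a_i` is the
average of `g^q` over a dilate of `B_i`. The first factor is small. The second is controlled by the
integral of `g^p` over a compact neighbourhood: since the `B_i` are disjoint and `p/q > 1`, this is
a discrete maximal theorem (`tsum_measure_mul_setLAverage_rpow_le`). So `H^t(f(E)) = 0`, and a
compact exhaustion removes the restriction on `E`.

The choice `s = t = Q` gives the statement on null sets; letting `s` decrease to `dim E` gives the
dimension bound. -/

theorem setLAverage_le_mul_of_subset {A B : Set X} {D : ℝ≥0∞} (hAB : A ⊆ B)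
    (hB : μ B ≠ ∞) (hD : μ B ≤ D * μ A) (f : X → ℝ≥0∞) :
    ⨍⁻ y in A, f y ∂μ ≤ D * ⨍⁻ y in B, f y ∂μ := by
  rw [setLAverage_eq, setLAverage_eq]
  by_cases hA : μ A = 0
  · simp [setLIntegral_measure_zero A f hA]
  have hA' : μ A ≠ ∞ := ne_top_of_le_ne_top hB (measure_mono hAB)
  have hB0 : μ B ≠ 0 := fun h => hA (measure_mono_null hAB h)
  rw [ENNReal.div_le_iff hA hA']
  calc ∫⁻ y in A, f y ∂μ ≤ ∫⁻ y in B, f y ∂μ := lintegral_mono_set hAB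
    _ = μ B * ((∫⁻ y in B, f y ∂μ) / μ B) := (ENNReal.mul_div_cancel hB0 hB).symm
    _ ≤ D * μ A * ((∫⁻ y in B, f y ∂μ) / μ B) := by gcongr
    _ = _ := by ring

theorem enorm_setAverage_sub_le {A : Set X} (hA : μ A ≠ 0) (hA' : μ A ≠ ∞) {u : X → ℝ}
    (hu : IntegrableOn u A μ) (c : ℝ) :
    ‖(⨍ y in A, u y ∂μ) - c‖ₑ ≤ ⨍⁻ y in A, ‖u y - c‖ₑ ∂μ := by
  have : IsFiniteMeasure (μ.restrict A) := ⟨by simpa using hA'.lt_top⟩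
  have : NeZero (μ.restrict A) := ⟨by simpa using hA⟩
  have h : (⨍ y in A, u y ∂μ) - c = ⨍ y in A, (u y - c) ∂μ := by
    unfold average
    rw [integral_sub hu.to_average (integrable_const _)]
    exact congrArg _ (average_const (μ.restrict A) c).symm
  rw [h]
  exact enorm_integral_le_lintegral_enorm _

theorem setLAverage_rpow_le_rpow {A : Set X} (hA : μ A ≠ 0) (hA' : μ A ≠ ∞) {g : X → ℝ≥0∞}
    (hg : Measurable g) {q q' : ℝ} (hq : 0 < q) (hqq' : q ≤ q') :
    (⨍⁻ y in A, g y ^ q ∂μ) ^ (1 / q) ≤ (⨍⁻ y in A, g y ^ q' ∂μ) ^ (1 / q') := by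
  have : IsFiniteMeasure (μ.restrict A) := ⟨by simpa using hA'.lt_top⟩
  have : NeZero (μ.restrict A) := ⟨by simpa using hA⟩
  have h := eLpNorm'_le_eLpNorm'_of_exponent_le hq hqq'
    ((μ.restrict A univ)⁻¹ • μ.restrict A) (f := g) hg.aestronglyMeasurable
  simpa [eLpNorm'_eq_lintegral_enorm, laverage] using h

end Averages

/-! ### Telescoping averages over shrinking balls -/

section Morrey

variable {X : Type*} [MetricSpace X] [ProperSpace X] [MeasurableSpace X] [BorelSpace X]
  {μ : Measure X} [μ.IsOpenPosMeasure] [IsFiniteMeasureOnCompacts μ]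

theorem tendsto_setAverage_ball {u : X → ℝ} (hu : Continuous u) (z : X) {ρ : ℕ → ℝ}
    (hρ : ∀ k, 0 < ρ k) (hρ0 : Filter.Tendsto ρ Filter.atTop (nhds 0)) :
    Filter.Tendsto (fun k => ⨍ y in Metric.ball z (ρ k), u y ∂μ) Filter.atTop (nhds (u z)) := by
  rw [EMetric.tendsto_nhds]
  intro ε hε
  obtain ⟨ε', hε', hεε'⟩ := exists_between hε
  obtain ⟨δ, hδ, hball⟩ := EMetric.continuous_iff.1 hu z ε' hε'
  have hδ' : ∀ᶠ k in Filter.atTop, ENNReal.ofReal (ρ k) < δ := by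
    have := ENNReal.tendsto_ofReal hρ0
    rw [ENNReal.ofReal_zero] at this
    exact this.eventually_lt_const hδ
  filter_upwards [hδ'] with k hk
  have h0 : μ (Metric.ball z (ρ k)) ≠ 0 := (Metric.measure_ball_pos μ z (hρ k)).ne'
  have h1 : μ (Metric.ball z (ρ k)) ≠ ∞ := measure_ball_lt_top.ne
  have hi : IntegrableOn u (Metric.ball z (ρ k)) μ :=
    (hu.continuousOn.integrableOn_compact (isCompact_closedBall z (ρ k))).mono_set
      Metric.ball_subset_closedBall
  rw [edist_eq_enorm_sub]
  refine lt_of_le_of_lt ((enorm_setAverage_sub_le h0 h1 hi (u z)).trans ?_) hεε'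
  rw [setLAverage_eq]
  refine ENNReal.div_le_of_le_mul ?_
  rw [← setLIntegral_const]
  refine setLIntegral_mono' measurableSet_ball fun y hy => ?_
  rw [← edist_eq_enorm_sub]
  refine (hball y ?_).le
  refine lt_trans ?_ hk
  rw [edist_dist]
  exact (ENNReal.ofReal_lt_ofReal_iff (hρ k)).2 hy

end Morrey

section Telescoping

theorem LocallyHomogeneous.exists_measure_ball_le {X : Type*} [MetricSpace X]
    [MeasurableSpace X] {μ : Measure X} {Q : ℝ} (hhom : LocallyHomogeneous μ Q)
    {K : Set X} (hK : IsCompact K) :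
    ∃ (R : ℝ) (C : ℝ≥0∞), 0 < R ∧ C ≠ ∞ ∧ ∀ x ∈ K, ∀ r s : ℝ, 0 < r → r ≤ s → s < R →
      μ (Metric.ball x s) ≤ C * ENNReal.ofReal ((s / r) ^ Q) * μ (Metric.ball x r) := by
  obtain ⟨R, C, hR, -, h⟩ := hhom K hK
  refine ⟨R, ENNReal.ofReal C, hR, ENNReal.ofReal_ne_top, fun x hx r s hr hrs hs => ?_⟩
  have hs0 : 0 < s := hr.trans_le hrs
  have hsQ : 0 < s ^ Q := Real.rpow_pos_of_pos hs0 Q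
  have hrQ : 0 < r ^ Q := Real.rpow_pos_of_pos hr Q
  have h1 := h x hx r s hr hrs hs
  rw [ENNReal.div_le_iff (by simpa using hsQ) ENNReal.ofReal_ne_top] at h1
  refine h1.trans_eq ?_
  rw [Real.div_rpow hs0.le hr.le, ENNReal.ofReal_div_of_pos hrQ, div_eq_mul_inv, div_eq_mul_inv]
  ring

variable {X : Type*} [MetricSpace X] [ProperSpace X] [MeasurableSpace X] [BorelSpace X]
  {μ : Measure X} [μ.IsOpenPosMeasure] [IsFiniteMeasureOnCompacts μ]

/-- With `a = ρ 2^(-k)`, Poincaré on `B(z, a)` bounds the step and Jensen raises the exponent from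
`Q` to `q`. Passing from the average over `B(z, σ a)` to the one over `B(z, σ ρ)` costs `2^(kQ)` by
homogeneity, and `2^(-k) 2^(kQ/q)` is the geometric factor. -/
theorem edist_average_ball_half_le {K : Set X} {Q q R R' σ : ℝ} {C C' : ℝ≥0∞} (hQ : 0 < Q)
    (hQq : Q ≤ q) (hσ : 1 ≤ σ)
    (hH : ∀ x ∈ K, ∀ r s : ℝ, 0 < r → r ≤ s → s < R →
      μ (Metric.ball x s) ≤ C * ENNReal.ofReal ((s / r) ^ Q) * μ (Metric.ball x r))
    {u : X → ℝ} {g : X → ℝ≥0∞} (hu : Continuous u) (hg : Measurable g)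
    (hP : ∀ x ∈ K, ∀ r : ℝ, 0 < r → r < R' →
        ⨍⁻ y in Metric.ball x r, ‖u y - ⨍ z in Metric.ball x r, u z ∂μ‖ₑ ∂μ ≤
          C' * Metric.ediam (Metric.ball x r) *
            (⨍⁻ y in Metric.ball x (σ * r), g y ^ Q ∂μ) ^ (1 / Q))
    {z : X} (hz : z ∈ K) {ρ : ℝ} (hρ : 0 < ρ) (hρR : σ * ρ < R) (hρR' : ρ < R') (k : ℕ) :
    edist (⨍ y in Metric.ball z (ρ * (1 / 2) ^ k), u y ∂μ)
        (⨍ y in Metric.ball z (ρ * (1 / 2) ^ (k + 1)), u y ∂μ) ≤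
      C * ENNReal.ofReal (2 ^ Q) * C' * 2 * C ^ (1 / q) * ENNReal.ofReal ρ *
        (⨍⁻ y in Metric.ball z (σ * ρ), g y ^ q ∂μ) ^ (1 / q) *
          ENNReal.ofReal (2 ^ (Q / q - 1)) ^ k := by
  have hq : 0 < q := hQ.trans_le hQq
  have hball : ∀ t : ℝ, 0 < t → μ (Metric.ball z t) ≠ 0 ∧ μ (Metric.ball z t) ≠ ∞ := fun t ht =>
    ⟨(Metric.measure_ball_pos μ z ht).ne', measure_ball_lt_top.ne⟩
  set a : ℝ := ρ * (1 / 2) ^ k with ha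
  have ha0 : 0 < a := by positivity
  have haρ : a ≤ ρ := mul_le_of_le_one_right hρ.le (pow_le_one₀ (by norm_num) (by norm_num))
  have hb : ρ * (1 / 2) ^ (k + 1) = a / 2 := by rw [ha, pow_succ]; ring
  have hσρ : ρ ≤ σ * ρ := le_mul_of_one_le_left hρ.le hσ
  have hσa : σ * a ≤ σ * ρ := by gcongr
  have hσa0 : 0 < σ * a := by positivity
  rw [hb, edist_comm, edist_eq_enorm_sub]
  have hi : IntegrableOn u (Metric.ball z (a / 2)) μ :=
    (hu.continuousOn.integrableOn_compact (isCompact_closedBall z (a / 2))).mono_set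
      Metric.ball_subset_closedBall
  have h1 := enorm_setAverage_sub_le (hball _ (half_pos ha0)).1 (hball _ (half_pos ha0)).2 hi
    (⨍ y in Metric.ball z a, u y ∂μ)
  have h2 : ⨍⁻ y in Metric.ball z (a / 2), ‖u y - ⨍ y in Metric.ball z a, u y ∂μ‖ₑ ∂μ ≤
      C * ENNReal.ofReal (2 ^ Q) *
        ⨍⁻ y in Metric.ball z a, ‖u y - ⨍ y in Metric.ball z a, u y ∂μ‖ₑ ∂μ := by
    refine setLAverage_le_mul_of_subset (Metric.ball_subset_ball (half_le_self ha0.le))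
      (hball a ha0).2 ?_ _
    have := hH z hz (a / 2) a (half_pos ha0) (half_le_self ha0.le) (by linarith)
    rwa [show a / (a / 2) = 2 by field_simp] at this
  have h3 := hP z hz a ha0 (haρ.trans_lt hρR')
  have h4 := setLAverage_rpow_le_rpow (hball _ hσa0).1 (hball _ hσa0).2 hg hQ hQq
  have h5 : ⨍⁻ y in Metric.ball z (σ * a), g y ^ q ∂μ ≤
      C * ENNReal.ofReal ((2 ^ k) ^ Q) * ⨍⁻ y in Metric.ball z (σ * ρ), g y ^ q ∂μ := by
    refine setLAverage_le_mul_of_subset (Metric.ball_subset_ball hσa)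
      (hball _ (by positivity)).2 ?_ _
    have := hH z hz (σ * a) (σ * ρ) hσa0 hσa hρR
    rwa [show σ * ρ / (σ * a) = 2 ^ k by rw [ha]; field_simp; simp] at this
  have h6 : Metric.ediam (Metric.ball z a) ≤ 2 * ENNReal.ofReal a := by
    rw [← Metric.eball_ofReal]
    exact Metric.ediam_eball_le
  have h7 : ENNReal.ofReal a * ENNReal.ofReal ((2 ^ k) ^ Q) ^ (1 / q) =
      ENNReal.ofReal ρ * ENNReal.ofReal (2 ^ (Q / q - 1)) ^ k := by
    rw [ENNReal.ofReal_rpow_of_nonneg (by positivity) (by positivity),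
      ← ENNReal.ofReal_mul ha0.le, ← ENNReal.ofReal_pow (by positivity),
      ← ENNReal.ofReal_mul hρ.le, ha, mul_assoc]
    congr 2
    rw [← Real.rpow_natCast, ← Real.rpow_natCast, ← Real.rpow_natCast, one_div,
      Real.inv_rpow (by norm_num), ← Real.rpow_neg (by norm_num), ← Real.rpow_mul (by norm_num),
      ← Real.rpow_mul (by norm_num), ← Real.rpow_mul (by norm_num), ← Real.rpow_add (by norm_num)]
    congr 1
    field_simp
    ring
  calc _ ≤ C * ENNReal.ofReal (2 ^ Q) * (C' * (2 * ENNReal.ofReal a) *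
        (C * ENNReal.ofReal ((2 ^ k) ^ Q) *
          ⨍⁻ y in Metric.ball z (σ * ρ), g y ^ q ∂μ) ^ (1 / q)) := by
        refine h1.trans (h2.trans ?_)
        gcongr
        refine h3.trans ?_
        gcongr
        exact h4.trans (by gcongr)
    _ = C * ENNReal.ofReal (2 ^ Q) * C' * 2 * C ^ (1 / q) *
        (ENNReal.ofReal a * ENNReal.ofReal ((2 ^ k) ^ Q) ^ (1 / q)) *
        (⨍⁻ y in Metric.ball z (σ * ρ), g y ^ q ∂μ) ^ (1 / q) := by
        rw [ENNReal.mul_rpow_of_nonneg _ _ (by positivity),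
          ENNReal.mul_rpow_of_nonneg _ _ (by positivity)]
        ring
    _ = _ := by rw [h7]; ring

/-- Continuity makes the averages converge to `u z` at every point, so the steps sum to a geometric
series. Its sum is finite exactly when `q > Q`. -/
theorem edist_average_ball_le {K : Set X} {Q q R R' σ : ℝ} {C C' : ℝ≥0∞} (hQ : 0 < Q)
    (hQq : Q ≤ q) (hσ : 1 ≤ σ)
    (hH : ∀ x ∈ K, ∀ r s : ℝ, 0 < r → r ≤ s → s < R →
      μ (Metric.ball x s) ≤ C * ENNReal.ofReal ((s / r) ^ Q) * μ (Metric.ball x r))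
    {u : X → ℝ} {g : X → ℝ≥0∞} (hu : Continuous u) (hg : Measurable g)
    (hP : ∀ x ∈ K, ∀ r : ℝ, 0 < r → r < R' →
        ⨍⁻ y in Metric.ball x r, ‖u y - ⨍ z in Metric.ball x r, u z ∂μ‖ₑ ∂μ ≤
          C' * Metric.ediam (Metric.ball x r) *
            (⨍⁻ y in Metric.ball x (σ * r), g y ^ Q ∂μ) ^ (1 / Q))
    {z : X} (hz : z ∈ K) {ρ : ℝ} (hρ : 0 < ρ) (hρR : σ * ρ < R) (hρR' : ρ < R') :
    edist (u z) (⨍ y in Metric.ball z ρ, u y ∂μ) ≤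
      C * ENNReal.ofReal (2 ^ Q) * C' * 2 * C ^ (1 / q) *
        (1 - ENNReal.ofReal (2 ^ (Q / q - 1)))⁻¹ * ENNReal.ofReal ρ *
        (⨍⁻ y in Metric.ball z (σ * ρ), g y ^ q ∂μ) ^ (1 / q) := by
  have hlim := tendsto_setAverage_ball (μ := μ) hu z (ρ := fun k => ρ * (1 / 2) ^ k)
    (fun k => by positivity) (by
      simpa using (tendsto_pow_atTop_nhds_zero_of_lt_one (r := (1 / 2 : ℝ)) (by norm_num)
        (by norm_num)).const_mul ρ)
  have h := edist_le_tsum_of_edist_le_of_tendsto₀ _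
    (edist_average_ball_half_le hQ hQq hσ hH hu hg hP hz hρ hρR hρR') hlim
  rw [ENNReal.tsum_mul_left, ENNReal.tsum_geometric] at h
  simp only [pow_zero, mul_one] at h
  rw [edist_comm]
  refine h.trans_eq ?_
  ring

end Telescoping

/-! ### The Morrey estimate -/

theorem IsUpperGradient.dist_const {X Y : Type*} [MetricSpace X] [MeasurableSpace X]
    [MetricSpace Y] {f : X → Y} {g : X → ℝ≥0∞} (hg : IsUpperGradient f g) (y : Y) :
    IsUpperGradient (fun x => dist (f x) y) g where
  measurable := hg.measurable
  edist_le γ hγ := by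
    refine le_trans ?_ (hg.edist_le γ hγ)
    rw [edist_dist, edist_dist]
    exact ENNReal.ofReal_le_ofReal (dist_dist_dist_le_left _ _ _)

section MorreyEstimate

variable {X Y : Type*} [MetricSpace X] [ProperSpace X] [MeasurableSpace X] [BorelSpace X]
  [MetricSpace Y] {μ : Measure X} [μ.IsOpenPosMeasure] [IsFiniteMeasureOnCompacts μ]

theorem IsUpperGradient.exists_edist_le {Q q : ℝ} (hQ : 1 ≤ Q) (hQq : Q < q)
    (hhom : LocallyHomogeneous μ Q) (hpoin : LocalPoincare μ Q) {f : X → Y} (hf : Continuous f)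
    {g : X → ℝ≥0∞} (hg : IsUpperGradient f g) {K : Set X} (hK : IsCompact K) :
    ∃ (r₀ Λ : ℝ) (M : ℝ≥0∞), 0 < r₀ ∧ 1 ≤ Λ ∧ M ≠ ∞ ∧ ∀ x ∈ K, ∀ r : ℝ, 0 < r → r < r₀ →
      ∀ z ∈ Metric.ball x r, edist (f x) (f z) ≤
        M * ENNReal.ofReal r * (⨍⁻ y in Metric.ball x (Λ * r), g y ^ q ∂μ) ^ (1 / q) := by
  have hQ0 : 0 < Q := by linarith
  have hq0 : 0 < q := by linarith
  -- The chain also uses balls centred at `z`, which lies near `K` but perhaps outside it.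
  have hK' : IsCompact (Metric.cthickening 1 K) := hK.cthickening
  obtain ⟨R, C, hR, hC, hH⟩ := hhom.exists_measure_ball_le hK'
  obtain ⟨C', σ, R', -, hσ, hR', hP⟩ := hpoin _ hK'
  have hσ0 : 0 < σ := by linarith
  set A : ℝ≥0∞ := C * ENNReal.ofReal (2 ^ Q) * ENNReal.ofReal C' * 2 * C ^ (1 / q) *
        (1 - ENNReal.ofReal (2 ^ (Q / q - 1)))⁻¹ with hA
  have hA' : A ≠ ∞ := by
    have h1 : ENNReal.ofReal (2 ^ (Q / q - 1)) < 1 := by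
      rw [← ENNReal.ofReal_one]
      refine (ENNReal.ofReal_lt_ofReal_iff one_pos).2 (Real.rpow_lt_one_of_one_lt_of_neg
        one_lt_two ?_)
      rw [sub_neg]
      exact (div_lt_one hq0).2 hQq
    have h2 : (1 - ENNReal.ofReal (2 ^ (Q / q - 1)))⁻¹ ≠ ∞ :=
      ENNReal.inv_ne_top.2 (tsub_pos_of_lt h1).ne'
    have h3 : C ^ (1 / q) ≠ ∞ := ENNReal.rpow_ne_top_of_nonneg (by positivity) hC
    finiteness
  set D : ℝ≥0∞ := C * ENNReal.ofReal (2 ^ Q) with hD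
  have hD' : D ≠ ∞ := by finiteness
  -- All comparisons rest on `B(z, 2r) ⊆ B(x, 3r) ⊆ B(z, 4r)` and the same inclusions dilated by
  -- `σ`; this dictates the factors 3 and 4.
  refine ⟨min 1 (min (R / (4 * σ)) (R' / 4)), σ * 3,
    A * 3 + D * ENNReal.ofReal C' * (2 * 3) + A * 3 * D ^ (1 / q), by positivity, by linarith,
    ?_, fun x hx r hr hr₀ z hz => ?_⟩
  · have h3 : D ^ (1 / q) ≠ ∞ := ENNReal.rpow_ne_top_of_nonneg (by positivity) hD'
    finiteness
  have hr1 : r < 1 := hr₀.trans_le (min_le_left _ _)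
  have hrR : σ * (4 * r) < R := by
    have := hr₀.trans_le ((min_le_right _ _).trans (min_le_left _ _))
    rw [lt_div_iff₀ (by positivity)] at this
    linarith
  have hrR' : 4 * r < R' := by
    have := hr₀.trans_le ((min_le_right _ _).trans (min_le_right _ _))
    linarith
  have hσr : r ≤ σ * r := le_mul_of_one_le_left hr.le hσ
  have hzx : dist z x < r := hz
  have hxz : dist x z < r := by rwa [dist_comm]
  have hxK : x ∈ Metric.cthickening 1 K := Metric.self_subset_cthickening K hx
  have hzK : z ∈ Metric.cthickening 1 K :=
    Metric.mem_cthickening_of_dist_le z x 1 K hx (by linarith)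
  have hball : ∀ (y : X) (t : ℝ), 0 < t → μ (Metric.ball y t) ≠ 0 ∧ μ (Metric.ball y t) ≠ ∞ :=
    fun y t ht => ⟨(Metric.measure_ball_pos μ y ht).ne', measure_ball_lt_top.ne⟩
  -- Poincaré concerns real functions, while `Y` is only a metric space: the distance to `f x` keeps
  -- the upper gradient and records exactly the oscillation wanted.
  set u : X → ℝ := fun y => dist (f y) (f x) with hu_def
  have hu : Continuous u := hf.dist continuous_const
  have hug : IsUpperGradient u g := hg.dist_const (f x)
  have hPu := hP u g hu hug
  have hmono : μ (Metric.ball z (σ * (4 * r))) ≤ D * μ (Metric.ball z (σ * (2 * r))) := by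
    have := hH z hzK (σ * (2 * r)) (σ * (4 * r)) (by positivity) (by gcongr; norm_num) hrR
    rwa [show σ * (4 * r) / (σ * (2 * r)) = 2 by field_simp; norm_num] at this
  set G : ℝ≥0∞ := ⨍⁻ y in Metric.ball x (σ * (3 * r)), g y ^ q ∂μ with hG
  have h3r : ENNReal.ofReal (3 * r) = 3 * ENNReal.ofReal r := by
    rw [ENNReal.ofReal_mul (by norm_num), ENNReal.ofReal_ofNat]
  have T1 : edist (u x) (⨍ y in Metric.ball x (3 * r), u y ∂μ) ≤
      A * (3 * ENNReal.ofReal r) * G ^ (1 / q) := by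
    rw [← h3r]
    exact edist_average_ball_le hQ0 hQq.le hσ hH hu hg.measurable hPu hxK (by positivity)
      (by nlinarith) (by linarith)
  have T2 : edist (⨍ y in Metric.ball z (2 * r), u y ∂μ) (⨍ y in Metric.ball x (3 * r), u y ∂μ) ≤
      D * (ENNReal.ofReal C' * (2 * (3 * ENNReal.ofReal r)) * G ^ (1 / q)) := by
    have hi : IntegrableOn u (Metric.ball z (2 * r)) μ :=
      (hu.continuousOn.integrableOn_compact (isCompact_closedBall z (2 * r))).mono_set
        Metric.ball_subset_closedBall
    rw [edist_eq_enorm_sub]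
    refine (enorm_setAverage_sub_le (hball _ _ (by positivity)).1 (hball _ _ (by positivity)).2 hi
      _).trans ?_
    have hsub : Metric.ball z (2 * r) ⊆ Metric.ball x (3 * r) :=
      Metric.ball_subset_ball' (by linarith)
    have hsub' : Metric.ball x (3 * r) ⊆ Metric.ball z (4 * r) :=
      Metric.ball_subset_ball' (by linarith)
    refine (setLAverage_le_mul_of_subset (D := D) hsub (hball _ _ (by positivity)).2 ?_ _).trans ?_
    · refine (measure_mono hsub').trans ?_
      have := hH z hzK (2 * r) (4 * r) (by positivity) (by linarith) (by nlinarith)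
      rwa [show 4 * r / (2 * r) = 2 by field_simp; norm_num] at this
    · gcongr
      refine (hPu x hxK (3 * r) (by positivity) (by linarith)).trans ?_
      gcongr
      · rw [← h3r, ← Metric.eball_ofReal]
        exact Metric.ediam_eball_le
      · exact setLAverage_rpow_le_rpow (hball _ _ (by positivity)).1 (hball _ _ (by positivity)).2
          hg.measurable hQ0 hQq.le
  have T3 : edist (u z) (⨍ y in Metric.ball z (2 * r), u y ∂μ) ≤
      A * (3 * ENNReal.ofReal r) * (D * G) ^ (1 / q) := by
    refine (edist_average_ball_le hQ0 hQq.le hσ hH hu hg.measurable hPu hzK (by positivity)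
      (by nlinarith) (by linarith)).trans ?_
    rw [← h3r]
    gcongr
    · linarith
    · refine setLAverage_le_mul_of_subset (Metric.ball_subset_ball' (by nlinarith))
        (hball _ _ (by positivity)).2 ?_ _
      refine (measure_mono (Metric.ball_subset_ball' ?_)).trans hmono
      nlinarith
  have hux : edist (f x) (f z) = edist (u z) (u x) := by
    simp only [hu_def, dist_self]
    rw [edist_comm, edist_dist, edist_dist, Real.dist_eq, sub_zero, abs_of_nonneg dist_nonneg]
  have hGeq : ⨍⁻ y in Metric.ball x (σ * 3 * r), g y ^ q ∂μ = G := by rw [hG, mul_assoc]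
  rw [hux, hGeq]
  calc edist (u z) (u x) ≤ edist (u z) (⨍ y in Metric.ball z (2 * r), u y ∂μ) +
        edist (⨍ y in Metric.ball z (2 * r), u y ∂μ) (⨍ y in Metric.ball x (3 * r), u y ∂μ) +
        edist (⨍ y in Metric.ball x (3 * r), u y ∂μ) (u x) := edist_triangle4 _ _ _ _
    _ ≤ A * (3 * ENNReal.ofReal r) * (D * G) ^ (1 / q) +
        D * (ENNReal.ofReal C' * (2 * (3 * ENNReal.ofReal r)) * G ^ (1 / q)) +
        A * (3 * ENNReal.ofReal r) * G ^ (1 / q) := by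
        rw [edist_comm _ (u x)]
        gcongr
    _ = _ := by
        rw [ENNReal.mul_rpow_of_nonneg _ _ (by positivity)]
        ring

end MorreyEstimate

/-! ### Layer-cake formula for powers -/

section LayerCake

theorem lintegral_indicator_rpow_of_ne_top {α : ℝ} (hα : 0 < α) {a : ℝ≥0∞} (ha : a ≠ ∞) :
    ∫⁻ t in Ioi (0 : ℝ), {t : ℝ | ENNReal.ofReal t < a}.indicator
      (fun t => ENNReal.ofReal (t ^ (α - 1))) t = a ^ α / ENNReal.ofReal α := by
  have hm : MeasurableSet {t : ℝ | ENNReal.ofReal t < a} :=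
    measurableSet_lt ENNReal.measurable_ofReal measurable_const
  have hset : {t : ℝ | ENNReal.ofReal t < a} ∩ Ioi 0 = Ioo 0 a.toReal := by
    ext t
    simp only [mem_inter_iff, mem_ofPred_eq, mem_Ioi, mem_Ioo]
    constructor
    · rintro ⟨h1, h2⟩
      exact ⟨h2, (ENNReal.ofReal_lt_iff_lt_toReal h2.le ha).1 h1⟩
    · rintro ⟨h1, h2⟩
      exact ⟨(ENNReal.ofReal_lt_iff_lt_toReal h1.le ha).2 h2, h1⟩
  rw [lintegral_indicator hm, Measure.restrict_restrict hm, hset,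
    Measure.restrict_congr_set Ioo_ae_eq_Ioc]
  have hint : IntervalIntegrable (fun t : ℝ => t ^ (α - 1)) volume 0 a.toReal :=
    intervalIntegral.intervalIntegrable_rpow' (by linarith)
  rw [← ofReal_integral_eq_lintegral_ofReal
    ((intervalIntegrable_iff_integrableOn_Ioc_of_le ENNReal.toReal_nonneg).1 hint)
    ((ae_restrict_mem measurableSet_Ioc).mono fun t ht => Real.rpow_nonneg ht.1.le _),
    ← intervalIntegral.integral_of_le ENNReal.toReal_nonneg, integral_rpow (Or.inl (by linarith))]
  rw [sub_add_cancel, Real.zero_rpow hα.ne', sub_zero, ENNReal.ofReal_div_of_pos hα,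
    ← ENNReal.ofReal_rpow_of_nonneg ENNReal.toReal_nonneg hα.le, ENNReal.ofReal_toReal ha]

theorem lintegral_indicator_rpow_le {α : ℝ} (hα : 0 < α) (a : ℝ≥0∞) :
    ∫⁻ t in Ioi (0 : ℝ), {t : ℝ | ENNReal.ofReal t < a}.indicator
      (fun t => ENNReal.ofReal (t ^ (α - 1))) t ≤ a ^ α / ENNReal.ofReal α := by
  rcases eq_or_ne a ∞ with rfl | ha
  · simp [ENNReal.top_rpow_of_pos hα, ENNReal.top_div_of_ne_top]
  · exact (lintegral_indicator_rpow_of_ne_top hα ha).le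

theorem rpow_le_lintegral_indicator {α : ℝ} (hα : 0 < α) (a : ℝ≥0∞) :
    a ^ α ≤ ENNReal.ofReal α * ∫⁻ t in Ioi (0 : ℝ), {t : ℝ | ENNReal.ofReal t < a}.indicator
      (fun t => ENNReal.ofReal (t ^ (α - 1))) t := by
  have hα0 : ENNReal.ofReal α ≠ 0 := by simpa using hα
  have key : ∀ b : ℝ≥0∞, b ≠ ∞ → b ≤ a → b ^ α ≤ ENNReal.ofReal α *
      ∫⁻ t in Ioi (0 : ℝ), {t : ℝ | ENNReal.ofReal t < a}.indicator
      (fun t => ENNReal.ofReal (t ^ (α - 1))) t := by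
    intro b hb hba
    calc b ^ α = ENNReal.ofReal α * (b ^ α / ENNReal.ofReal α) :=
          (ENNReal.mul_div_cancel hα0 ENNReal.ofReal_ne_top).symm
      _ ≤ _ := by
          rw [← lintegral_indicator_rpow_of_ne_top hα hb]
          gcongr
  rcases eq_or_ne a ∞ with rfl | ha
  -- For infinite `a`, truncating at `b = r^(1/α)` shows that the right side exceeds every finite
  -- `r`.
  · rw [ENNReal.top_rpow_of_pos hα, top_le_iff]
    refine ENNReal.eq_top_of_forall_nnreal_le fun r => ?_
    have := key ((r : ℝ≥0∞) ^ (1 / α))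
      (ENNReal.rpow_ne_top_of_nonneg (by positivity) ENNReal.coe_ne_top) le_top
    rwa [← ENNReal.rpow_mul, one_div_mul_cancel hα.ne', ENNReal.rpow_one] at this
  · exact key a ha le_rfl

end LayerCake

/-! ### A discrete maximal inequality -/

section Embedding

variable {X ι : Type*} [MetricSpace X] [ProperSpace X] [MeasurableSpace X] [BorelSpace X]
  {μ : Measure X} [IsFiniteMeasureOnCompacts μ] [Countable ι]

/-- A weak-type bound. Vitali extracts disjoint balls from those with large average, and their
enlargements cover the selected `U i`. As the average exceeds `2c` while the part of `h` below `c`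
contributes at most `c`, the set where `h > c` supplies the rest. -/
theorem tsum_measure_mul_le_lintegral_indicator {U : ι → Set X} {x : ι → X} {s : ι → ℝ} {R : ℝ}
    {D : ℝ≥0∞} {V : Set X} (hs : ∀ i, 0 < s i) (hsR : ∀ i, s i ≤ R)
    (hU : ∀ i, MeasurableSet (U i)) (hdisj : Pairwise (Function.onFun Disjoint U))
    (hUB : ∀ i, U i ⊆ Metric.ball (x i) (s i)) (hBV : ∀ i, Metric.ball (x i) (s i) ⊆ V)
    (hD : ∀ i, μ (Metric.ball (x i) (6 * s i)) ≤ D * μ (Metric.ball (x i) (s i)))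
    {h : X → ℝ≥0∞} (hh : Measurable h) {c : ℝ≥0∞} (hc : c ≠ ∞) :
    (∑' i, {i | 2 * c < ⨍⁻ y in Metric.ball (x i) (s i), h y ∂μ}.indicator
      (fun i => μ (U i)) i) * c ≤ D * ∫⁻ y in V, {y | c < h y}.indicator h y ∂μ := by
  set T : Set ι := {i | 2 * c < ⨍⁻ y in Metric.ball (x i) (s i), h y ∂μ} with hT
  obtain ⟨J, hJT, hJd, hJ⟩ := Vitali.exists_disjoint_subfamily_covering_enlargement_closedBall
    -- Factor 5 is for closed balls; the hypothesis with 6 leaves room to return to open ones.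
    T x s R (fun i _ => hsR i) 5 (by norm_num)
  have hmc : MeasurableSet {y | c < h y} := measurableSet_lt measurable_const hh
  have hBf : ∀ i, μ (Metric.ball (x i) (s i)) ≠ ∞ := fun i => measure_ball_lt_top.ne
  have hJc : J.Countable := J.to_countable
  have hB : ∀ j ∈ J, μ (Metric.ball (x j) (s j)) * c ≤
      ∫⁻ y in Metric.ball (x j) (s j), {y | c < h y}.indicator h y ∂μ := by
    intro j hj
    have h1 : 2 * c < ⨍⁻ y in Metric.ball (x j) (s j), h y ∂μ := hJT hj
    have h2 : μ (Metric.ball (x j) (s j)) * (2 * c) ≤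
        ∫⁻ y in Metric.ball (x j) (s j), h y ∂μ := by
      rw [← measure_mul_setLAverage h (hBf j)]
      gcongr
    have h3 : ∫⁻ y in Metric.ball (x j) (s j), h y ∂μ ≤ μ (Metric.ball (x j) (s j)) * c +
        ∫⁻ y in Metric.ball (x j) (s j), {y | c < h y}.indicator h y ∂μ := by
      rw [mul_comm (μ _), ← setLIntegral_const, ← lintegral_add_left measurable_const]
      refine lintegral_mono fun y => ?_
      by_cases hy : c < h y
      · simp [hy]
      · simpa [indicator, hy] using not_lt.1 hy
    have h4 := h2.trans h3
    rw [show μ (Metric.ball (x j) (s j)) * (2 * c) =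
      μ (Metric.ball (x j) (s j)) * c + μ (Metric.ball (x j) (s j)) * c by ring] at h4
    exact (ENNReal.add_le_add_iff_left (ENNReal.mul_ne_top (hBf j) hc)).1 h4
  have hcover : ⋃ i ∈ T, U i ⊆ ⋃ j ∈ J, Metric.ball (x j) (6 * s j) := by
    refine iUnion₂_subset fun i hi => ?_
    obtain ⟨j, hj, hij⟩ := hJ i hi
    refine subset_iUnion₂_of_subset j hj ?_
    refine ((hUB i).trans (Metric.ball_subset_closedBall.trans hij)).trans ?_
    exact Metric.closedBall_subset_ball (by linarith [hs j])
  have hJd' : J.PairwiseDisjoint fun j => Metric.ball (x j) (s j) := fun i hi j hj hij =>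
    (hJd hi hj hij).mono Metric.ball_subset_closedBall Metric.ball_subset_closedBall
  calc (∑' i, T.indicator (fun i => μ (U i)) i) * c = μ (⋃ i ∈ T, U i) * c := by
        rw [measure_biUnion T.to_countable (fun i _ j _ hij => hdisj hij) (fun i _ => hU i),
          tsum_subtype T fun i => μ (U i)]
    _ ≤ (∑' j : J, μ (Metric.ball (x j) (6 * s j))) * c := by
        gcongr
        exact (measure_mono hcover).trans (measure_biUnion_le μ hJc _)
    _ ≤ (∑' j : J, D * μ (Metric.ball (x j) (s j))) * c := by
        gcongr with j
        exact hD j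
    _ = D * ∑' j : J, μ (Metric.ball (x j) (s j)) * c := by
        rw [ENNReal.tsum_mul_left, ENNReal.tsum_mul_right, mul_assoc]
    _ ≤ D * ∑' j : J, ∫⁻ y in Metric.ball (x j) (s j), {y | c < h y}.indicator h y ∂μ := by
        gcongr with j
        exact hB j j.2
    _ = D * ∫⁻ y in ⋃ j ∈ J, Metric.ball (x j) (s j), {y | c < h y}.indicator h y ∂μ := by
        rw [lintegral_biUnion hJc (fun j _ => measurableSet_ball) hJd']
    _ ≤ _ := by
        gcongr
        exact iUnion₂_subset fun j _ => hBV j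

/-- Marcinkiewicz interpolation: the weak bound at level `t/2` is integrated against `t^(α - 1)`,
and Tonelli leaves `∫ t^(α - 2)` over `0 < t < 2h`, finite where `h` is because `α > 1`. Only the `U
i` are disjoint; the averaging balls may overlap freely. -/
theorem tsum_measure_mul_setLAverage_rpow_le {U : ι → Set X} {x : ι → X} {s : ι → ℝ} {R : ℝ}
    {D : ℝ≥0∞} {V : Set X} (hs : ∀ i, 0 < s i) (hsR : ∀ i, s i ≤ R)
    (hU : ∀ i, MeasurableSet (U i)) (hdisj : Pairwise (Function.onFun Disjoint U))
    (hUB : ∀ i, U i ⊆ Metric.ball (x i) (s i)) (hBV : ∀ i, Metric.ball (x i) (s i) ⊆ V)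
    (hD : ∀ i, μ (Metric.ball (x i) (6 * s i)) ≤ D * μ (Metric.ball (x i) (s i)))
    {h : X → ℝ≥0∞} (hh : Measurable h) {α : ℝ} (hα : 1 < α) :
    ∑' i, μ (U i) * (⨍⁻ y in Metric.ball (x i) (s i), h y ∂μ) ^ α ≤
      ENNReal.ofReal α * (2 * D * (2 ^ (α - 1) / ENNReal.ofReal (α - 1))) *
        ∫⁻ y in V, h y ^ α ∂μ := by
  have hα0 : 0 < α := by linarith
  have hα1 : 0 < α - 1 := by linarith
  set a : ι → ℝ≥0∞ := fun i => ⨍⁻ y in Metric.ball (x i) (s i), h y ∂μ with ha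
  have hmeas : ∀ b : ℝ≥0∞, MeasurableSet {t : ℝ | ENNReal.ofReal t < b} := fun b =>
    measurableSet_lt ENNReal.measurable_ofReal measurable_const
  have hmeas_rpow : ∀ β : ℝ, Measurable fun t : ℝ => ENNReal.ofReal (t ^ β) := fun β =>
    (measurable_id.pow_const β).ennreal_ofReal
  have hlevel : ∀ t ∈ Ioi (0 : ℝ), ∑' i, μ (U i) * {t : ℝ | ENNReal.ofReal t < a i}.indicator
      (fun t => ENNReal.ofReal (t ^ (α - 1))) t ≤
      2 * D * ∫⁻ y in V, h y * {t : ℝ | ENNReal.ofReal t < 2 * h y}.indicator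
        (fun t => ENNReal.ofReal (t ^ (α - 1 - 1))) t ∂μ := by
    intro t ht
    have ht0 : (0 : ℝ) < t := ht
    have h1 := tsum_measure_mul_le_lintegral_indicator (c := ENNReal.ofReal (t / 2)) hs hsR hU
      hdisj hUB hBV hD hh ENNReal.ofReal_ne_top
    have h2 : 2 * ENNReal.ofReal (t / 2) = ENNReal.ofReal t := by
      rw [← ENNReal.ofReal_ofNat, ← ENNReal.ofReal_mul (by norm_num)]
      congr 1
      ring
    rw [h2] at h1
    -- The factor `t/2` is split off to be absorbed by the weak-type bound.
    have h3 : ENNReal.ofReal (t ^ (α - 1)) =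
        ENNReal.ofReal (t / 2) * (2 * ENNReal.ofReal (t ^ (α - 1 - 1))) := by
      rw [Real.rpow_sub_one ht0.ne' (α - 1), ← ENNReal.ofReal_ofNat,
        ← ENNReal.ofReal_mul (by norm_num), ← ENNReal.ofReal_mul (by positivity)]
      congr 1
      field_simp
    have hlt : ∀ b : ℝ≥0∞, ENNReal.ofReal (t / 2) < b ↔ ENNReal.ofReal t < 2 * b := by
      intro b
      rw [← h2, ENNReal.mul_lt_mul_iff_right two_ne_zero ENNReal.ofNat_ne_top]
    calc ∑' i, μ (U i) * {t : ℝ | ENNReal.ofReal t < a i}.indicator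
          (fun t => ENNReal.ofReal (t ^ (α - 1))) t
        = (∑' i, {i | ENNReal.ofReal t < a i}.indicator (fun i => μ (U i)) i) *
            ENNReal.ofReal (t ^ (α - 1)) := by
          rw [← ENNReal.tsum_mul_right]
          congr 1 with i
          by_cases hi : ENNReal.ofReal t < a i <;> simp [indicator, hi]
      _ = (∑' i, {i | ENNReal.ofReal t < a i}.indicator (fun i => μ (U i)) i) *
            ENNReal.ofReal (t / 2) * (2 * ENNReal.ofReal (t ^ (α - 1 - 1))) := by
          rw [h3]; ring
      _ ≤ (D * ∫⁻ y in V, {y | ENNReal.ofReal (t / 2) < h y}.indicator h y ∂μ) *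
            (2 * ENNReal.ofReal (t ^ (α - 1 - 1))) := by gcongr
      _ = 2 * D * (ENNReal.ofReal (t ^ (α - 1 - 1)) *
            ∫⁻ y in V, {y | ENNReal.ofReal (t / 2) < h y}.indicator h y ∂μ) := by ring
      _ = _ := by
          rw [← lintegral_const_mul' _ _ ENNReal.ofReal_ne_top]
          congr 1
          refine lintegral_congr fun y => ?_
          simp only [indicator, mem_ofPred_eq, hlt (h y)]
          split_ifs <;> simp [mul_comm]
  have hjoint : Measurable fun z : ℝ × X => h z.2 * {t : ℝ | ENNReal.ofReal t < 2 * h z.2}.indicator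
      (fun t => ENNReal.ofReal (t ^ (α - 1 - 1))) z.1 := by
    refine (hh.comp measurable_snd).mul ?_
    exact Measurable.indicator (s := {z : ℝ × X | ENNReal.ofReal z.1 < 2 * h z.2})
      (f := fun z => ENNReal.ofReal (z.1 ^ (α - 1 - 1)))
      ((hmeas_rpow _).comp measurable_fst)
      (measurableSet_lt (ENNReal.measurable_ofReal.comp measurable_fst)
        ((hh.comp measurable_snd).const_mul 2))
  calc ∑' i, μ (U i) * a i ^ α
      ≤ ∑' i, μ (U i) * (ENNReal.ofReal α * ∫⁻ t in Ioi (0 : ℝ),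
          {t : ℝ | ENNReal.ofReal t < a i}.indicator
            (fun t => ENNReal.ofReal (t ^ (α - 1))) t) := by
        gcongr with i
        exact rpow_le_lintegral_indicator hα0 (a i)
    _ = ENNReal.ofReal α * ∑' i, ∫⁻ t in Ioi (0 : ℝ), μ (U i) *
          {t : ℝ | ENNReal.ofReal t < a i}.indicator
            (fun t => ENNReal.ofReal (t ^ (α - 1))) t := by
        rw [← ENNReal.tsum_mul_left]
        congr 1 with i
        rw [lintegral_const_mul _ ((hmeas_rpow _).indicator (hmeas _))]
        ring
    _ = ENNReal.ofReal α * ∫⁻ t in Ioi (0 : ℝ), ∑' i, μ (U i) *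
          {t : ℝ | ENNReal.ofReal t < a i}.indicator
            (fun t => ENNReal.ofReal (t ^ (α - 1))) t := by
        rw [lintegral_tsum fun i =>
          (((hmeas_rpow _).indicator (hmeas _)).const_mul _).aemeasurable]
    _ ≤ ENNReal.ofReal α * ∫⁻ t in Ioi (0 : ℝ), 2 * D * ∫⁻ y in V, h y *
          {t : ℝ | ENNReal.ofReal t < 2 * h y}.indicator
            (fun t => ENNReal.ofReal (t ^ (α - 1 - 1))) t ∂μ := by
        gcongr 1
        exact setLIntegral_mono' measurableSet_Ioi hlevel
    _ = ENNReal.ofReal α * (2 * D * ∫⁻ y in V, h y * (∫⁻ t in Ioi (0 : ℝ),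
          {t : ℝ | ENNReal.ofReal t < 2 * h y}.indicator
            (fun t => ENNReal.ofReal (t ^ (α - 1 - 1))) t) ∂μ) := by
        rw [lintegral_const_mul _ hjoint.lintegral_prod_right',
          lintegral_lintegral_swap hjoint.aemeasurable]
        congr 2
        refine lintegral_congr fun y => ?_
        exact lintegral_const_mul (h y) ((hmeas_rpow _).indicator (hmeas (2 * h y)))
    _ ≤ ENNReal.ofReal α * (2 * D * ∫⁻ y in V, h y *
          ((2 * h y) ^ (α - 1) / ENNReal.ofReal (α - 1)) ∂μ) := by
        gcongr with y
        exact lintegral_indicator_rpow_le hα1 _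
    _ = ENNReal.ofReal α * (2 * D * ∫⁻ y in V,
          (2 ^ (α - 1) / ENNReal.ofReal (α - 1)) * h y ^ α ∂μ) := by
        congr 2
        refine lintegral_congr fun y => ?_
        have : h y ^ α = h y * h y ^ (α - 1) := by
          conv_lhs => rw [show α = 1 + (α - 1) by ring,
            ENNReal.rpow_add_of_nonneg _ _ zero_le_one hα1.le, ENNReal.rpow_one]
        rw [this, ENNReal.mul_rpow_of_nonneg _ _ hα1.le, div_eq_mul_inv, div_eq_mul_inv]
        ring
    _ = _ := by
        rw [lintegral_const_mul _ (hh.pow_const α)]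
        ring

end Embedding

/-! ### Covers and Hausdorff null sets -/

theorem exists_disjoint_ball_cover {X ι : Type*} [MetricSpace X] {E : Set X} {x : ι → X} {r : ι → ℝ} {R : ℝ}
    (hr : ∀ i, 0 < r i) (hR : ∀ i, r i ≤ R) (hE : E ⊆ ⋃ i, Metric.ball (x i) (r i)) :
    ∃ J : Set ι, (J.PairwiseDisjoint fun i => Metric.ball (x i) (r i)) ∧
      E ⊆ ⋃ j : J, Metric.ball (x j) (6 * r j) := by
  obtain ⟨J, -, hJd, hJ⟩ := Vitali.exists_disjoint_subfamily_covering_enlargement_closedBall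
    univ x r R (fun i _ => hR i) 5 (by norm_num)
  refine ⟨J, fun i hi j hj hij => (hJd hi hj hij).mono Metric.ball_subset_closedBall
    Metric.ball_subset_closedBall, fun y hy => ?_⟩
  obtain ⟨i, hi⟩ := mem_iUnion.1 (hE hy)
  obtain ⟨j, hj, hij⟩ := hJ i (mem_univ i)
  refine mem_iUnion.2 ⟨⟨j, hj⟩, ?_⟩
  exact Metric.closedBall_subset_ball (by linarith [hr j])
    (hij (Metric.ball_subset_closedBall hi))

section HausdorffNull

variable {X : Type*} [MetricSpace X] [MeasurableSpace X] [BorelSpace X]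

theorem exists_ball_cover_of_hausdorffMeasure_eq_zero {E : Set X} {s : ℝ} (hs : 0 < s)
    (hE : Measure.hausdorffMeasure s E = 0) {ε : ℝ≥0∞} (hε : ε ≠ 0) :
    ∃ (ι : Type) (x : ι → X) (r : ι → ℝ), Countable ι ∧ (∀ i, x i ∈ E) ∧ (∀ i, 0 < r i) ∧
      E ⊆ ⋃ i, Metric.ball (x i) (r i) ∧ ∑' i, ENNReal.ofReal (r i) ^ s ≤ ε := by
  have hε2 : ε / 2 ≠ 0 := (ENNReal.half_pos hε).ne'
  have h1 := hE
  rw [Measure.hausdorffMeasure_apply] at h1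
  have h2 := (ENNReal.iSup_eq_zero.1 ((ENNReal.iSup_eq_zero.1 h1) 1)) one_pos
  have h3 := h2.trans_lt (pos_iff_ne_zero.2 hε2)
  simp only [iInf_lt_iff] at h3
  obtain ⟨t, hEt, htd, ht⟩ := h3
  obtain ⟨w, hw0, hw⟩ := ENNReal.exists_pos_sum_of_countable hε2 ℕ
  -- The weights `w n`, of total at most `ε / 2`, make each radius strictly larger than the
  -- diameter, so that even a single point gets a genuine open ball.
  set b : ℕ → ℝ≥0∞ := fun n => (Metric.ediam (t n) ^ s + w n) ^ (1 / s) with hb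
  have hbt : ∀ n, b n ≠ ∞ := fun n => by
    refine ENNReal.rpow_ne_top_of_nonneg (by positivity) (ENNReal.add_ne_top.2 ⟨?_, by simp⟩)
    exact ENNReal.rpow_ne_top_of_nonneg hs.le (ne_top_of_le_ne_top ENNReal.one_ne_top (htd n))
  have hbs : ∀ n, b n ^ s = Metric.ediam (t n) ^ s + w n := fun n => by
    rw [hb, ← ENNReal.rpow_mul, one_div_mul_cancel hs.ne', ENNReal.rpow_one]
  have hbd : ∀ n, Metric.ediam (t n) < b n := fun n => by
    rw [← ENNReal.rpow_lt_rpow_iff hs, hbs]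
    refine ENNReal.lt_add_right (ENNReal.rpow_ne_top_of_nonneg hs.le
      (ne_top_of_le_ne_top ENNReal.one_ne_top (htd n))) (by simpa using (hw0 n).ne')
  choose x hx using fun i : {n // (t n ∩ E).Nonempty} => i.2
  refine ⟨{n // (t n ∩ E).Nonempty}, x, fun i => (b i).toReal, inferInstance,
    fun i => (hx i).2, fun i => ENNReal.toReal_pos (zero_le.trans_lt (hbd i)).ne' (hbt i), ?_, ?_⟩
  · intro y hy
    obtain ⟨n, hn⟩ := mem_iUnion.1 (hEt hy)
    refine mem_iUnion.2 ⟨⟨n, ⟨y, hn, hy⟩⟩, ?_⟩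
    rw [Metric.mem_ball, dist_edist]
    refine ENNReal.toReal_strict_mono (hbt n) (lt_of_le_of_lt ?_ (hbd n))
    exact Metric.edist_le_ediam_of_mem hn (hx ⟨n, ⟨y, hn, hy⟩⟩).1
  · calc ∑' i : {n // (t n ∩ E).Nonempty}, ENNReal.ofReal (b i).toReal ^ s
        = ∑' i : {n // (t n ∩ E).Nonempty},
          ((⨆ _ : (t i).Nonempty, Metric.ediam (t i) ^ s) + w i) := by
          refine tsum_congr fun i => ?_
          rw [ENNReal.ofReal_toReal (hbt i), hbs]
          have : (t i).Nonempty := i.2.mono inter_subset_left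
          simp [this]
      _ ≤ ∑' n, ((⨆ _ : (t n).Nonempty, Metric.ediam (t n) ^ s) + (w n : ℝ≥0∞)) :=
          ENNReal.tsum_comp_le_tsum_of_injective Subtype.val_injective
            fun n => (⨆ _ : (t n).Nonempty, Metric.ediam (t n) ^ s) + (w n : ℝ≥0∞)
      _ ≤ ε / 2 + ε / 2 := by
          rw [ENNReal.tsum_add]
          gcongr
      _ = ε := ENNReal.add_halves ε

/-- No mesh condition is needed: each term is at most the sum, so every diameter is at most
`ε^(1/s)`. -/
theorem hausdorffMeasure_eq_zero_of_forall_cover {E : Set X} {s : ℝ} (hs : 0 < s)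
    (h : ∀ ε : ℝ≥0∞, ε ≠ 0 → ∃ (ι : Type*) (t : ι → Set X), Countable ι ∧ E ⊆ ⋃ i, t i ∧
      ∑' i, Metric.ediam (t i) ^ s ≤ ε) :
    Measure.hausdorffMeasure s E = 0 := by
  have hpos : ∀ n : ℕ, ((n : ℝ≥0∞) + 1)⁻¹ ≠ 0 := fun n => by simp
  choose ι t hι hcov hsum using fun n : ℕ => h ((n : ℝ≥0∞) + 1)⁻¹ (hpos n)
  have hlim : Filter.Tendsto (fun n : ℕ => ((n : ℝ≥0∞) + 1)⁻¹) Filter.atTop (nhds 0) := by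
    have := (Filter.tendsto_add_atTop_iff_nat 1).2 ENNReal.tendsto_inv_nat_nhds_zero
    simpa using this
  have hlim' : Filter.Tendsto (fun n : ℕ => (((n : ℝ≥0∞) + 1)⁻¹) ^ (1 / s)) Filter.atTop
      (nhds 0) := by
    have := hlim.ennrpow_const (1 / s)
    rwa [ENNReal.zero_rpow_of_pos (by positivity)] at this
  have h1 := Measure.hausdorffMeasure_le_liminf_tsum s E _ hlim' t
    (Filter.Eventually.of_forall fun n i => by
      rw [one_div, ENNReal.le_rpow_inv_iff hs]
      exact (ENNReal.le_tsum i).trans (hsum n))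
    (Filter.Eventually.of_forall hcov)
  refine le_antisymm (h1.trans ?_) zero_le
  refine (Filter.liminf_le_liminf (Filter.Eventually.of_forall hsum)).trans ?_
  exact hlim.liminf_eq.le

end HausdorffNull

/-! ### Lower mass bound and finite dimension -/

section LowerMass

variable {X : Type*} [MetricSpace X] [MeasurableSpace X]
  {μ : Measure X} [μ.IsOpenPosMeasure]

theorem IsCompact.exists_le_measure_ball {K : Set X} (hK : IsCompact K) {ρ : ℝ} (hρ : 0 < ρ) :
    ∃ m : ℝ≥0∞, m ≠ 0 ∧ ∀ x ∈ K, m ≤ μ (Metric.ball x ρ) := by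
  refine hK.induction_on (p := fun S => ∃ m : ℝ≥0∞, m ≠ 0 ∧ ∀ x ∈ S, m ≤ μ (Metric.ball x ρ))
    ⟨1, one_ne_zero, by simp⟩ ?_ ?_ ?_
  · rintro S T hST ⟨m, hm, h⟩
    exact ⟨m, hm, fun x hx => h x (hST hx)⟩
  · rintro S T ⟨m, hm, h⟩ ⟨n, hn, h'⟩
    refine ⟨min m n, (lt_min (pos_iff_ne_zero.2 hm) (pos_iff_ne_zero.2 hn)).ne', ?_⟩
    rintro x (hx | hx)
    · exact (min_le_left _ _).trans (h x hx)
    · exact (min_le_right _ _).trans (h' x hx)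
  · intro x _
    refine ⟨Metric.ball x (ρ / 2), mem_nhdsWithin_of_mem_nhds (Metric.ball_mem_nhds x (half_pos hρ)),
      μ (Metric.ball x (ρ / 2)), (Metric.measure_ball_pos μ x (half_pos hρ)).ne', fun y hy => ?_⟩
    refine measure_mono (Metric.ball_subset_ball' ?_)
    have : dist x y < ρ / 2 := by rwa [dist_comm]
    linarith

theorem LocallyHomogeneous.exists_rpow_le_measure_ball {Q : ℝ}
    (hhom : LocallyHomogeneous μ Q) {K : Set X} (hK : IsCompact K) :
    ∃ (R : ℝ) (c : ℝ≥0∞), 0 < R ∧ c ≠ ∞ ∧ ∀ x ∈ K, ∀ r : ℝ, 0 < r → r ≤ R →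
      ENNReal.ofReal r ^ Q ≤ c * μ (Metric.ball x r) := by
  obtain ⟨R, C, hR, hC, hH⟩ := hhom.exists_measure_ball_le hK
  obtain ⟨m, hm, hmK⟩ := hK.exists_le_measure_ball (μ := μ) (half_pos hR)
  -- Homogeneity is compared with the fixed scale `R / 2`. Truncating `m` at 1 keeps it finite, so
  -- that it cancels against its inverse.
  refine ⟨R / 2, (min m 1)⁻¹ * (C * ENNReal.ofReal ((R / 2) ^ Q)), half_pos hR, ?_,
    fun x hx r hr hrR => ?_⟩
  · have : (min m 1)⁻¹ ≠ ∞ :=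
      ENNReal.inv_ne_top.2 (lt_min (pos_iff_ne_zero.2 hm) one_pos).ne'
    finiteness
  have hr' : 0 < r ^ Q := Real.rpow_pos_of_pos hr Q
  have h1 : min m 1 ≤ C * ENNReal.ofReal ((R / 2 / r) ^ Q) * μ (Metric.ball x r) :=
    (min_le_left _ _).trans ((hmK x hx).trans (hH x hx r (R / 2) hr hrR (half_lt_self hR)))
  have hm0 : min m 1 ≠ 0 := (lt_min (pos_iff_ne_zero.2 hm) one_pos).ne'
  have hm1 : min m 1 ≠ ∞ := ne_top_of_le_ne_top ENNReal.one_ne_top (min_le_right _ _)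
  calc ENNReal.ofReal r ^ Q = (min m 1)⁻¹ * (min m 1 * ENNReal.ofReal (r ^ Q)) := by
        rw [← mul_assoc, ENNReal.inv_mul_cancel hm0 hm1, one_mul, ENNReal.ofReal_rpow_of_pos hr]
    _ ≤ (min m 1)⁻¹ * (C * ENNReal.ofReal ((R / 2 / r) ^ Q) * μ (Metric.ball x r) *
          ENNReal.ofReal (r ^ Q)) := by gcongr
    _ = (min m 1)⁻¹ * (C * (ENNReal.ofReal ((R / 2 / r) ^ Q) * ENNReal.ofReal (r ^ Q)) *
          μ (Metric.ball x r)) := by ring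
    _ = _ := by
        rw [← ENNReal.ofReal_mul (by positivity), Real.div_rpow (by positivity) hr.le,
          div_mul_cancel₀ _ hr'.ne']
        ring

variable [ProperSpace X] [BorelSpace X] [IsFiniteMeasureOnCompacts μ]

/-- Disjoint `r`-balls centred in `K` each have mass at least a multiple of `r^Q`, inside a set of
finite measure. So `∑ r^(Q + 1)` over them is `O(r)`, and their enlargements cover `K`. -/
theorem LocallyHomogeneous.hausdorffMeasure_eq_zero {Q : ℝ} (hQ : 0 ≤ Q)
    (hhom : LocallyHomogeneous μ Q) {K : Set X} (hK : IsCompact K) :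
    Measure.hausdorffMeasure (Q + 1) K = 0 := by
  obtain ⟨R, c, hR, hc, h⟩ := hhom.exists_rpow_le_measure_ball hK
  have hV : μ (Metric.cthickening 1 K) ≠ ∞ := hK.cthickening.measure_lt_top.ne
  set B : ℝ≥0∞ := 12 ^ (Q + 1) * c * μ (Metric.cthickening 1 K) with hB
  have hB' : B ≠ ∞ := by
    have : (12 : ℝ≥0∞) ^ (Q + 1) ≠ ∞ :=
      ENNReal.rpow_ne_top_of_nonneg (by positivity) ENNReal.ofNat_ne_top
    finiteness
  refine hausdorffMeasure_eq_zero_of_forall_cover (by linarith) fun ε hε => ?_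
  have hlim : Filter.Tendsto (fun r : ℝ => B * ENNReal.ofReal r) (nhdsWithin 0 (Ioi 0))
      (nhds 0) := by
    have h1 : Filter.Tendsto ENNReal.ofReal (nhdsWithin 0 (Ioi 0)) (nhds 0) := by
      have := (ENNReal.continuous_ofReal.tendsto 0).mono_left
        (nhdsWithin_le_nhds (s := Ioi (0 : ℝ)))
      rwa [ENNReal.ofReal_zero] at this
    simpa using ENNReal.Tendsto.const_mul h1 (Or.inr hB')
  obtain ⟨r, hrε, hr⟩ := ((hlim.eventually_lt_const (pos_iff_ne_zero.2 hε)).and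
    (Ioo_mem_nhdsGT (lt_min one_pos hR))).exists
  have hr0 : 0 < r := hr.1
  obtain ⟨J, hJ, hcov⟩ := exists_disjoint_ball_cover (E := K) (x := fun x : K => (x : X))
    (r := fun _ => r) (R := r) (fun _ => hr0) (fun _ => le_rfl)
    fun x hx => mem_iUnion.2 ⟨⟨x, hx⟩, Metric.mem_ball_self hr0⟩
  have hJc : J.Countable := hJ.countable_of_isOpen (fun _ _ => Metric.isOpen_ball)
    fun x _ => ⟨x, Metric.mem_ball_self hr0⟩
  have : Countable J := hJc
  have hQ1 : (0 : ℝ) ≤ Q + 1 := by linarith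
  have hr' : ENNReal.ofReal r ≠ 0 := by simpa using hr0
  refine ⟨J, fun j => Metric.ball (j : X) (6 * r), this, hcov, ?_⟩
  calc ∑' j : J, Metric.ediam (Metric.ball ((j : K) : X) (6 * r)) ^ (Q + 1)
      ≤ ∑' j : J, 12 ^ (Q + 1) * ENNReal.ofReal r * (c * μ (Metric.ball ((j : K) : X) r)) := by
        refine ENNReal.tsum_le_tsum fun j => ?_
        calc Metric.ediam (Metric.ball ((j : K) : X) (6 * r)) ^ (Q + 1)
            ≤ (12 * ENNReal.ofReal r) ^ (Q + 1) := by
              refine ENNReal.rpow_le_rpow ?_ hQ1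
              rw [← Metric.eball_ofReal]
              refine Metric.ediam_eball_le.trans_eq ?_
              rw [ENNReal.ofReal_mul (by norm_num), ENNReal.ofReal_ofNat, ← mul_assoc]
              norm_num
          _ = 12 ^ (Q + 1) * ENNReal.ofReal r * ENNReal.ofReal r ^ Q := by
              rw [ENNReal.mul_rpow_of_nonneg _ _ hQ1,
                ENNReal.rpow_add _ _ hr' ENNReal.ofReal_ne_top, ENNReal.rpow_one]
              ring
          _ ≤ _ := by
              gcongr
              exact h j j.1.2 r hr0 (hr.2.le.trans (min_le_right _ _))
    _ = 12 ^ (Q + 1) * ENNReal.ofReal r * c * ∑' j : J, μ (Metric.ball ((j : K) : X) r) := by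
        rw [← ENNReal.tsum_mul_left]
        refine tsum_congr fun j => ?_
        ring
    _ = 12 ^ (Q + 1) * ENNReal.ofReal r * c *
          μ (⋃ j : J, Metric.ball ((j : K) : X) r) := by
        rw [measure_iUnion (f := fun j : J => Metric.ball ((j : K) : X) r)
          (fun i j hij => hJ i.2 j.2 (Subtype.coe_injective.ne hij)) fun _ => measurableSet_ball]
    _ ≤ 12 ^ (Q + 1) * ENNReal.ofReal r * c * μ (Metric.cthickening 1 K) := by
        gcongr
        refine iUnion_subset fun j y hy => ?_
        have hy' : dist y (j : K) < r := hy
        exact Metric.mem_cthickening_of_dist_le y (j : K) 1 K j.1.2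
          (hy'.le.trans (hr.2.le.trans (min_le_left _ _)))
    _ = B * ENNReal.ofReal r := by rw [hB]; ring
    _ ≤ ε := hrε.le

end LowerMass

/-! ### Hölder's inequality and the image of a null set -/

theorem ENNReal.tsum_rpow_mul_rpow_le {ι : Type*} (a b : ι → ℝ≥0∞) {θ η : ℝ} (hθ : 0 ≤ θ)
    (hη : 0 ≤ η) (h : θ + η = 1) :
    ∑' i, a i ^ θ * b i ^ η ≤ (∑' i, a i) ^ θ * (∑' i, b i) ^ η := by
  let _ : MeasurableSpace ι := ⊤
  have := ENNReal.lintegral_mul_norm_pow_le (μ := Measure.count) (f := a) (g := b)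
    measurable_from_top.aemeasurable measurable_from_top.aemeasurable hθ hη h
  simpa only [lintegral_count] using this

/-- The hypothesis on `t` is `t = s(1 - t/p) + Q t/p` cleared of denominators; the part `r^(Q t/p)`
is traded for mass, which prepares Hölder with exponents `1 - t/p` and `t/p`. -/
theorem rpow_mul_rpow_le_of_rpow_le_mul {Q p q s t r : ℝ} (hq : 0 < q) (hp : 0 < p)
    (ht : 0 ≤ t) (hst : t * (p - Q + s) = p * s) (hr : 0 < r) {a c m : ℝ≥0∞}
    (hm : ENNReal.ofReal r ^ Q ≤ c * m) :
    (ENNReal.ofReal r * a ^ (1 / q)) ^ t ≤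
      c ^ (t / p) * ((ENNReal.ofReal r ^ s) ^ (1 - t / p) * (m * a ^ (p / q)) ^ (t / p)) := by
  have htp : 0 ≤ t / p := by positivity
  have hr' : ENNReal.ofReal r ≠ 0 := by simpa using hr
  calc (ENNReal.ofReal r * a ^ (1 / q)) ^ t
      = (ENNReal.ofReal r ^ s) ^ (1 - t / p) * (ENNReal.ofReal r ^ Q) ^ (t / p) *
          (a ^ (p / q)) ^ (t / p) := by
        rw [ENNReal.mul_rpow_of_nonneg _ _ ht, ← ENNReal.rpow_mul, ← ENNReal.rpow_mul,
          ← ENNReal.rpow_mul, ← ENNReal.rpow_mul, ← ENNReal.rpow_add _ _ hr' ENNReal.ofReal_ne_top]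
        congr 2
        · field_simp
          linarith
        · field_simp
    _ ≤ (ENNReal.ofReal r ^ s) ^ (1 - t / p) * (c * m) ^ (t / p) * (a ^ (p / q)) ^ (t / p) := by
        gcongr
    _ = _ := by
        rw [ENNReal.mul_rpow_of_nonneg _ _ htp, ENNReal.mul_rpow_of_nonneg _ _ htp]
        ring

section HausdorffImage

variable {X Y : Type*} [MetricSpace X] [ProperSpace X] [MeasurableSpace X] [BorelSpace X]
  [MetricSpace Y] [MeasurableSpace Y] [BorelSpace Y]
  {μ : Measure X} [μ.IsOpenPosMeasure] [IsFiniteMeasureOnCompacts μ]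

theorem IsUpperGradient.hausdorffMeasure_image_eq_zero_of_subset {Q p s t : ℝ} (hQ : 1 ≤ Q)
    (hQp : Q < p) (hhom : LocallyHomogeneous μ Q) (hpoin : LocalPoincare μ Q) {f : X → Y}
    (hf : Continuous f) {g : X → ℝ≥0∞} (hg : IsUpperGradient f g) (hgp : LocallyLp μ p g)
    (hs : 0 < s) (hst : t * (p - Q + s) = p * s) {K E : Set X} (hK : IsCompact K) (hEK : E ⊆ K)
    (hE : Measure.hausdorffMeasure s E = 0) :
    Measure.hausdorffMeasure t (f '' E) = 0 := by
  have hp0 : 0 < p := by linarith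
  have hpQ : 0 < p - Q + s := by linarith
  have ht : 0 < t := pos_of_mul_pos_left (hst ▸ by positivity) hpQ.le
  have htp : t / p < 1 := by
    rw [div_lt_one hp0]
    have : t * (p - Q + s) < p * (p - Q + s) := by rw [hst]; nlinarith
    exact lt_of_mul_lt_mul_right this hpQ.le
  have htp0 : 0 < t / p := by positivity
  -- `q > Q` serves the Morrey estimate, `q < p` the maximal inequality with exponent `p/q > 1`.
  obtain ⟨q, hQq, hqp⟩ := exists_between hQp
  have hq0 : 0 < q := by linarith
  obtain ⟨r₀, Λ, M, hr₀, hΛ, hM, hmorrey⟩ := hg.exists_edist_le hQ hQq hhom hpoin hf hK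
  obtain ⟨R, D, hR, hD, hdbl⟩ := hhom.exists_measure_ball_le hK
  obtain ⟨R', c, hR', hc, hmass⟩ := hhom.exists_rpow_le_measure_ball hK
  have hΛ0 : 0 < Λ := by linarith
  set V : Set X := Metric.cthickening 1 K with hV
  set I : ℝ≥0∞ := ∫⁻ y in V, g y ^ p ∂μ with hI
  have hI' : I ≠ ∞ := (hgp.2 V hK.cthickening).ne
  set N : ℝ≥0∞ := ENNReal.ofReal (p / q) * (2 * (D * ENNReal.ofReal (6 ^ Q)) *
    (2 ^ (p / q - 1) / ENNReal.ofReal (p / q - 1))) * I with hN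
  have hpq : 1 < p / q := (one_lt_div hq0).2 hqp
  have hN' : N ≠ ∞ := by
    have h1 : (2 : ℝ≥0∞) ^ (p / q - 1) / ENNReal.ofReal (p / q - 1) ≠ ∞ := by
      refine ENNReal.div_ne_top (ENNReal.rpow_ne_top_of_nonneg (by linarith)
        ENNReal.ofNat_ne_top) ?_
      simpa using hpq
    finiteness
  set B : ℝ≥0∞ := (M * 12) ^ t * (c ^ (t / p) * N ^ (t / p)) with hB
  have hB' : B ≠ ∞ := by
    refine ENNReal.mul_ne_top (ENNReal.rpow_ne_top_of_nonneg ht.le (by finiteness))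
      (ENNReal.mul_ne_top ?_ ?_) <;>
    exact ENNReal.rpow_ne_top_of_nonneg htp0.le ‹_›
  refine hausdorffMeasure_eq_zero_of_forall_cover ht fun ε hε => ?_
  -- In turn: Morrey on the 6-fold balls, homogeneity from radius `6Λr` to `36Λr`, the mass bound,
  -- and containment of the averaging balls in `V`.
  obtain ⟨ρ, hρ0, hρ⟩ : ∃ ρ : ℝ, 0 < ρ ∧ 6 * ρ < r₀ ∧ Λ * (36 * ρ) < R ∧ ρ ≤ R' ∧
      Λ * (6 * ρ) ≤ 1 := by
    refine ⟨min (min (r₀ / 12) (R / (72 * Λ))) (min R' (1 / (6 * Λ))), by positivity, ?_⟩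
    set ρ := min (min (r₀ / 12) (R / (72 * Λ))) (min R' (1 / (6 * Λ)))
    have h1 : ρ ≤ r₀ / 12 := (min_le_left _ _).trans (min_le_left _ _)
    have h2 : ρ ≤ R / (72 * Λ) := (min_le_left _ _).trans (min_le_right _ _)
    have h3 : ρ ≤ R' := (min_le_right _ _).trans (min_le_left _ _)
    have h4 : ρ ≤ 1 / (6 * Λ) := (min_le_right _ _).trans (min_le_right _ _)
    rw [le_div_iff₀ (by positivity)] at h2 h4
    exact ⟨by linarith, by linarith, h3, by linarith⟩
  obtain ⟨hρ1, hρ2, hρ3, hρ4⟩ := hρ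
  -- The bound by `ρ^s` forces every radius of the cover below `ρ`.
  obtain ⟨ε', hε'0, hε'1, hε'2⟩ : ∃ ε' : ℝ≥0∞, ε' ≠ 0 ∧ ε' ≤ ENNReal.ofReal ρ ^ s ∧
      B * ε' ^ (1 - t / p) ≤ ε := by
    have h1 : Filter.Tendsto (fun x : ℝ≥0∞ => B * x ^ (1 - t / p)) (nhds 0) (nhds 0) := by
      have := ENNReal.Tendsto.const_mul
        ((ENNReal.continuous_rpow_const (y := 1 - t / p)).tendsto 0) (Or.inr hB')
      rwa [ENNReal.zero_rpow_of_pos (by linarith), mul_zero] at this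
    have h2 : (0 : ℝ≥0∞) < ENNReal.ofReal ρ ^ s :=
      ENNReal.rpow_pos (by simpa using hρ0) ENNReal.ofReal_ne_top
    have h3 := ((h1.eventually_lt_const (pos_iff_ne_zero.2 hε)).and
      (eventually_lt_nhds h2)).filter_mono (nhdsWithin_le_nhds (s := Ioi 0))
    obtain ⟨ε', ⟨h4, h5⟩, h6⟩ := (h3.and self_mem_nhdsWithin).exists
    exact ⟨ε', (mem_Ioi.1 h6).ne', h5.le, h4.le⟩
  obtain ⟨ι, x, r, hι, hxE, hr, hcov, hsum⟩ :=
    exists_ball_cover_of_hausdorffMeasure_eq_zero hs hE hε'0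
  have hrρ : ∀ i, r i ≤ ρ := fun i => by
    have h1 := (ENNReal.le_tsum i).trans (hsum.trans hε'1)
    rwa [ENNReal.rpow_le_rpow_iff hs, ENNReal.ofReal_le_ofReal_iff hρ0.le] at h1
  obtain ⟨J, hJd, hJcov⟩ := exists_disjoint_ball_cover hr hrρ hcov
  have hxK : ∀ i, x i ∈ K := fun i => hEK (hxE i)
  set a : J → ℝ≥0∞ := fun j => ⨍⁻ y in Metric.ball (x j) (Λ * (6 * r j)), g y ^ q ∂μ with ha
  have hemb : ∑' j : J, μ (Metric.ball (x j) (r j)) * a j ^ (p / q) ≤ N := by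
    have h1 := tsum_measure_mul_setLAverage_rpow_le (μ := μ)
      (U := fun j : J => Metric.ball (x j) (r j)) (x := fun j : J => x j)
      (s := fun j : J => Λ * (6 * r j)) (R := Λ * (6 * ρ)) (D := D * ENNReal.ofReal (6 ^ Q))
      (V := V) (h := fun y => g y ^ q) (α := p / q)
      (fun j => by have := hr j; positivity) (fun j => by have := hrρ j; gcongr)
      (fun j => measurableSet_ball)
      (fun i j hij => hJd i.2 j.2 (Subtype.coe_injective.ne hij))
      (fun j => Metric.ball_subset_ball (by have := hr j; nlinarith))
      (fun j y hy => by
        have hy' : dist y (x j) < Λ * (6 * r j) := hy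
        refine Metric.mem_cthickening_of_dist_le y (x j) 1 K (hxK j) (hy'.le.trans ?_)
        refine le_trans ?_ hρ4
        have := hrρ j
        gcongr)
      (fun j => by
        have h0 := hr j
        have h1 : Λ * (36 * r j) ≤ Λ * (36 * ρ) := by have := hrρ j; gcongr
        have h2 := hdbl (x j) (hxK j) (Λ * (6 * r j)) (6 * (Λ * (6 * r j))) (by positivity)
          (by nlinarith [mul_pos hΛ0 h0]) (by linarith)
        rwa [show 6 * (Λ * (6 * r j)) / (Λ * (6 * r j)) = 6 by field_simp] at h2)
      (hg.measurable.pow_const q) hpq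
    refine h1.trans_eq ?_
    have h2 : ∀ y, (g y ^ q) ^ (p / q) = g y ^ p := fun y => by
      rw [← ENNReal.rpow_mul, mul_div_cancel₀ _ hq0.ne']
    simp only [h2, hN, hI]
  refine ⟨J, fun j => f '' Metric.ball (x j) (6 * r j), inferInstance, ?_, ?_⟩
  · rw [← image_iUnion]
    exact image_mono hJcov
  have hdiam : ∀ j : J, Metric.ediam (f '' Metric.ball (x j) (6 * r j)) ≤
      M * 12 * (ENNReal.ofReal (r j) * a j ^ (1 / q)) := fun j => by
    have h0 := hr j
    have h1 : ∀ z ∈ Metric.ball (x j) (6 * r j), edist (f (x j)) (f z) ≤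
        M * 6 * (ENNReal.ofReal (r j) * a j ^ (1 / q)) := fun z hz => by
      refine (hmorrey (x j) (hxK j) (6 * r j) (by positivity) (by linarith [hrρ j]) z hz).trans_eq ?_
      rw [ENNReal.ofReal_mul (by norm_num), ENNReal.ofReal_ofNat]
      ring
    refine Metric.ediam_le ?_
    rintro _ ⟨z, hz, rfl⟩ _ ⟨w, hw, rfl⟩
    calc edist (f z) (f w) ≤ edist (f (x j)) (f z) + edist (f (x j)) (f w) :=
          edist_triangle_left _ _ _
      _ ≤ M * 6 * (ENNReal.ofReal (r j) * a j ^ (1 / q)) +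
          M * 6 * (ENNReal.ofReal (r j) * a j ^ (1 / q)) := add_le_add (h1 z hz) (h1 w hw)
      _ = _ := by ring
  calc ∑' j : J, Metric.ediam (f '' Metric.ball (x j) (6 * r j)) ^ t
      ≤ ∑' j : J, (M * 12) ^ t * (c ^ (t / p) * ((ENNReal.ofReal (r j) ^ s) ^ (1 - t / p) *
          (μ (Metric.ball (x j) (r j)) * a j ^ (p / q)) ^ (t / p))) := by
        refine ENNReal.tsum_le_tsum fun j => ?_
        refine (ENNReal.rpow_le_rpow (hdiam j) ht.le).trans ?_
        rw [ENNReal.mul_rpow_of_nonneg _ _ ht.le]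
        gcongr
        exact rpow_mul_rpow_le_of_rpow_le_mul hq0 hp0 ht.le hst (hr j)
          (hmass (x j) (hxK j) (r j) (hr j) ((hrρ j).trans hρ3))
    _ = (M * 12) ^ t * (c ^ (t / p) * ∑' j : J, (ENNReal.ofReal (r j) ^ s) ^ (1 - t / p) *
          (μ (Metric.ball (x j) (r j)) * a j ^ (p / q)) ^ (t / p)) := by
        rw [ENNReal.tsum_mul_left, ENNReal.tsum_mul_left]
    _ ≤ (M * 12) ^ t * (c ^ (t / p) * ((∑' j : J, ENNReal.ofReal (r j) ^ s) ^ (1 - t / p) *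
          (∑' j : J, μ (Metric.ball (x j) (r j)) * a j ^ (p / q)) ^ (t / p))) := by
        gcongr
        exact ENNReal.tsum_rpow_mul_rpow_le _ _ (by linarith) htp0.le (by ring)
    _ ≤ (M * 12) ^ t * (c ^ (t / p) * (ε' ^ (1 - t / p) * N ^ (t / p))) := by
        gcongr
        exact (ENNReal.tsum_comp_le_tsum_of_injective Subtype.val_injective
          fun i => ENNReal.ofReal (r i) ^ s).trans hsum
    _ = B * ε' ^ (1 - t / p) := by rw [hB]; ring
    _ ≤ ε := hε'2

theorem IsUpperGradient.hausdorffMeasure_image_eq_zero {Q p s t : ℝ} (hQ : 1 ≤ Q)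
    (hQp : Q < p) (hhom : LocallyHomogeneous μ Q) (hpoin : LocalPoincare μ Q) {f : X → Y}
    (hf : Continuous f) {g : X → ℝ≥0∞} (hg : IsUpperGradient f g) (hgp : LocallyLp μ p g)
    (hs : 0 < s) (hst : t * (p - Q + s) = p * s) {E : Set X}
    (hE : Measure.hausdorffMeasure s E = 0) :
    Measure.hausdorffMeasure t (f '' E) = 0 := by
  have h1 : E = ⋃ n, E ∩ compactCovering X n := by
    rw [← inter_iUnion, iUnion_compactCovering, inter_univ]
  rw [h1, image_iUnion]
  refine measure_iUnion_null fun n => ?_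
  exact hg.hausdorffMeasure_image_eq_zero_of_subset hQ hQp hhom hpoin hf hgp hs hst
    (isCompact_compactCovering X n) inter_subset_right (measure_mono_null inter_subset_left hE)

/-- Infinite dimension must be excluded: in `ℝ≥0∞` the quotient in the final bound would become `∞ /
∞ = 0`. -/
theorem LocallyHomogeneous.dimH_ne_top {Q : ℝ} (hQ : 0 ≤ Q) (hhom : LocallyHomogeneous μ Q)
    (E : Set X) : dimH E ≠ ∞ := by
  have h : Measure.hausdorffMeasure (Q + 1) (univ : Set X) = 0 := by
    rw [← iUnion_compactCovering X]
    exact measure_iUnion_null fun n =>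
      hhom.hausdorffMeasure_eq_zero hQ (isCompact_compactCovering X n)
  have h1 : dimH (univ : Set X) ≤ ((Q + 1).toNNReal : ℝ≥0∞) := by
    refine dimH_le_of_hausdorffMeasure_ne_top ?_
    rw [Real.coe_toNNReal _ (by linarith), h]
    exact ENNReal.zero_ne_top
  exact ne_top_of_le_ne_top ENNReal.coe_ne_top ((dimH_mono (subset_univ E)).trans h1)

theorem IsUpperGradient.dimH_image_le {Q p : ℝ} (hQ : 1 ≤ Q)
    (hQp : Q < p) (hhom : LocallyHomogeneous μ Q) (hpoin : LocalPoincare μ Q) {f : X → Y}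
    (hf : Continuous f) {g : X → ℝ≥0∞} (hg : IsUpperGradient f g) (hgp : LocallyLp μ p g)
    (E : Set X) :
    dimH (f '' E) ≤ ENNReal.ofReal p * dimH E / (ENNReal.ofReal (p - Q) + dimH E) := by
  have hpQ : 0 < p - Q := by linarith
  have hp0 : 0 < p := by linarith
  lift dimH E to NNReal using hhom.dimH_ne_top (by linarith) E with d hd
  have hden : ∀ s : ℝ, (d : ℝ) ≤ s → 0 < p - Q + s := fun s hs => by
    have : (0 : ℝ) ≤ s := d.coe_nonneg.trans hs
    linarith
  have hlim : Filter.Tendsto (fun s : ℝ => ENNReal.ofReal (p * s / (p - Q + s)))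
      (nhdsWithin (d : ℝ) (Ioi (d : ℝ))) (nhds (ENNReal.ofReal (p * d / (p - Q + d)))) := by
    refine ENNReal.tendsto_ofReal (Filter.Tendsto.mono_left ?_ nhdsWithin_le_nhds)
    refine ContinuousAt.tendsto (f := fun s : ℝ => p * s / (p - Q + s)) ?_
    exact ContinuousAt.div (by fun_prop) (by fun_prop) (hden d le_rfl).ne'
  have hle : dimH (f '' E) ≤ ENNReal.ofReal (p * d / (p - Q + d)) := by
    -- `H^s(E) = 0` is guaranteed only for `s > dim E`, so the bound is obtained there and passed to
    -- the limit from the right.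
    refine ge_of_tendsto hlim ?_
    filter_upwards [self_mem_nhdsWithin] with s hs
    have hds : (d : ℝ) < s := hs
    have hs0 : 0 < s := d.coe_nonneg.trans_lt hds
    have hE : Measure.hausdorffMeasure s E = 0 := by
      have h1 : dimH E < (s.toNNReal : ℝ≥0∞) := by
        rw [← hd, ENNReal.coe_lt_coe, Real.lt_toNNReal_iff_coe_lt]
        exact hds
      have := hausdorffMeasure_of_dimH_lt h1
      rwa [Real.coe_toNNReal _ hs0.le] at this
    have hfE := hg.hausdorffMeasure_image_eq_zero (t := p * s / (p - Q + s)) hQ hQp hhom hpoin hf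
      hgp hs0 (div_mul_cancel₀ _ (hden s hds.le).ne') hE
    refine dimH_le_of_hausdorffMeasure_ne_top (d := (p * s / (p - Q + s)).toNNReal) ?_
    rw [Real.coe_toNNReal _ (div_nonneg (by positivity) (hden s hds.le).le), hfE]
    exact ENNReal.zero_ne_top
  refine hle.trans_eq ?_
  rw [ENNReal.ofReal_div_of_pos (hden d le_rfl), ENNReal.ofReal_mul hp0.le,
    ENNReal.ofReal_add hpQ.le d.coe_nonneg, ENNReal.ofReal_coe_nnreal]

end HausdorffImage

theorem theorem1p1 {X Y : Type*}
    [MetricSpace X] [ProperSpace X] [MeasurableSpace X] [BorelSpace X]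
    [MetricSpace Y] [MeasurableSpace Y] [BorelSpace Y]
    (μ : Measure X) [μ.IsOpenPosMeasure] [IsFiniteMeasureOnCompacts μ]
    (Q p : ℝ) (hQ : 1 ≤ Q) (hQp : Q < p)
    (hhom : LocallyHomogeneous μ Q) (hpoin : LocalPoincare μ Q)
    (f : X → Y) (hf : Continuous f)
    (hgrad : ∃ g : X → ℝ≥0∞, IsUpperGradient f g ∧ LocallyLp μ p g) :
    (∀ E : Set X, dimH (f '' E) ≤
      ENNReal.ofReal p * dimH E / (ENNReal.ofReal (p - Q) + dimH E)) ∧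
    (∀ E : Set X, Measure.hausdorffMeasure Q E = 0 →
      Measure.hausdorffMeasure Q (f '' E) = 0) := by
  obtain ⟨g, hg, hgp⟩ := hgrad
  refine ⟨fun E => hg.dimH_image_le hQ hQp hhom hpoin hf hgp E, fun E hE => ?_⟩
  exact hg.hausdorffMeasure_image_eq_zero hQ hQp hhom hpoin hf hgp (by linarith) (by ring) hE
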